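/- **Large deviation principle for the halo shape.** Let $\kappa>1$ and $L>4$, let $\mathbb T=\mathbb R^2/(L\mathbb Z)^2$ be the torus with its flat Euclidean distance and Lebesgue measure $|\cdot|$, and write $B_2(x)$ for the closed disc of radius $2$ centred at $x\in\mathbb T$. Let $\Gamma$ be the set of finite subsets $\gamma\subset\mathbb T$, with $N(\gamma)=\#\gamma$, halo $h(\gamma)=\bigcup_{x\in\gamma}B_2(x)$ and $V(\gamma)=|h(\gamma)|$. For $\beta\ge 1$ let $\mu_\beta$ be the Widom–Rowlinson Gibbs measure $$\mu_\beta(\mathrm d\gamma)=\frac1{\Xi_\beta}\,e^{-\beta H_\beta(\gamma)}\,\mathbb Q(\mathrm d\gamma)=\frac1{\Xi_\beta}\,(\kappa\beta)^{N(\gamma)}e^{-\beta V(\gamma)}\,\mathbb Q(\mathrm d\gamma),$$ where $\mathbb Q$ is the law of the Poisson point process of intensity $1$ on $\mathbb T$, $H_\beta(\gamma)=V(\gamma)-4\pi N(\gamma)-\lambda_\beta N(\gamma)$ with $e^{\beta\lambda_\beta}=\kappa\beta e^{-4\pi\beta}$, and $\Xi_\beta$ is the normalising constant. Let $\mathcal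 S$ be the set of admissible sets, i.e. of all $S=\bigcup_{x\in F}B_2(x)$ with $F\subset\mathbb T$ non-empty and closed. For closed $S\subset\mathbb T$ put $S^-=\{x\in S: B_2(x)\subset S\}$ and $$J(S)=|S|-\kappa|S^-|,\qquad I(S)=J(S)-\inf_{\mathcal S}J .$$ Equip the closed subsets of $\mathbb T$ with the Hausdorff metric and let $\emptyset=h(\emptyset)$ be an isolated point. Then $\mu_\beta(h(\gamma)\in\cdot\,)$, $\beta\ge1$, is a family of probability measures on $\mathcal S\cup\{\emptyset\}$, and as $\beta\to\infty$ it satisfies the large deviation principle with speed $\beta$ and good rate function $I$, both on $\mathcal S\cup\{\emptyset\}$ and, restricted to (the Borel subsets of) $\mathcal S$, on $\mathcal S$. That is, for $\mathcal X=\mathcal S\cup\{\emptyset\}$ and for $\mathcal X=\mathcal S$: the function $I:\mathcal X\to[0,\infty)$ is lower semicontinuous with compact level sets $\{I\le a\}$, $a\in\mathbb R$; for all closed $C\subset\mathcal X$ and all open $O\subset\mathcal X$, $$\limsup_{\beta\to\infty}\frac1\beta\log\mu_\beta(h(\gamma)\in C)\le-\inf_{C}I,\qquad \liminf_{\beta\to\infty}\frac1\beta\log\mu_\beta(h(\gamma)\in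 O)\ge-\inf_{O}I .$$ -/

import Mathlib

open MeasureTheory Filter Topology TopologicalSpace
open scoped ENNReal

noncomputable section

namespace WidomRowlinson

/-! ### The torus -/

/-- The torus `ℝ² / (L ℤ)²` with the Euclidean (flat) distance: the `ℓ²`-product of two circles
of length `L`. -/
abbrev Torus (L : ℝ) : Type := WithLp 2 (AddCircle L × AddCircle L)

/-- Lebesgue measure on the torus, of total mass `L ^ 2`. -/
def area (L : ℝ) [Fact (0 < L)] : Measure (Torus L) :=
  (volume : Measure (AddCircle L × AddCircle L)).map (WithLp.toLp 2)

instance (L : ℝ) [Fact (0 < L)] : IsFiniteMeasure (area L) := by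
  unfold area; infer_instance

/-! ### Halos, erosion, admissible sets -/

/-- The `2`-halo of a set: the union of the closed discs of radius `2` centred in the set. -/
def dilation {L : ℝ} (F : Set (Torus L)) : Set (Torus L) :=
  ⋃ x ∈ F, Metric.closedBall x 2

/-- The `2`-interior `S⁻ = {x ∈ S : B₂(x) ⊆ S}` of a set. -/
def erosion {L : ℝ} (S : Set (Torus L)) : Set (Torus L) :=
  {x ∈ S | Metric.closedBall x 2 ⊆ S}

/-- The admissible sets: the `2`-halos of the non-empty closed subsets of the torus. The type
`Closeds (Torus L)` carries the Hausdorff (extended) metric, for which the empty set is at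
infinite distance from every other closed set. -/
def admissible (L : ℝ) : Set (Closeds (Torus L)) :=
  {S | ∃ F : Closeds (Torus L), (F : Set (Torus L)).Nonempty ∧
    dilation (F : Set (Torus L)) = (S : Set (Torus L))}

/-- Borel `σ`-algebra of the Hausdorff metric on the closed subsets of the torus. -/
instance (L : ℝ) : MeasurableSpace (Closeds (Torus L)) := borel _

instance (L : ℝ) : BorelSpace (Closeds (Torus L)) := ⟨rfl⟩

/-! ### Particle configurations and the Poisson point process -/

/-- A finite configuration of indistinguishable, non-coinciding particles in the torus. -/
structure Configuration (L : ℝ) where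
  /-- the set of particle positions -/
  points : Finset (Torus L)

variable {L : ℝ}

/-- The `σ`-algebra generated by the counting variables `γ ↦ #(γ ∩ A)`, `A` Borel. -/
instance : MeasurableSpace (Configuration L) :=
  ⨆ A : {A : Set (Torus L) // MeasurableSet A},
    MeasurableSpace.comap
      (fun γ : Configuration L => ((γ.points : Set (Torus L)) ∩ A).ncard) ⊤

open scoped Classical in
/-- The configuration that consists of the points of an `n`-tuple. -/
def ofTuple {n : ℕ} (x : Fin n → Torus L) : Configuration L :=
  ⟨Finset.univ.image x⟩

/-- The law of the Poisson point process of intensity `1` on the torus: a Poisson number of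
independent uniform points, that is, `∑ₙ e^{-|𝕋|} / n! ∫ dx₁ ⋯ dxₙ δ_{\{x₁, …, xₙ\}}`. -/
def poissonLaw (L : ℝ) [Fact (0 < L)] : Measure (Configuration L) :=
  Measure.sum fun n : ℕ =>
    ENNReal.ofReal (Real.exp (-(area L).real Set.univ) / n.factorial) •
      (Measure.pi fun _ : Fin n => area L).map ofTuple

/-- The map in the definition of the Poisson law is measurable, so that the image measures
there are the genuine ones. -/
theorem measurable_ofTuple {L : ℝ} [Fact (0 < L)] (n : ℕ) :
    Measurable (ofTuple : (Fin n → Torus L) → Configuration L) := by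
  classical
  rw [measurable_iff_comap_le, instMeasurableSpaceConfiguration, MeasurableSpace.comap_iSup]
  refine iSup_le fun A => ?_
  rw [MeasurableSpace.comap_comp, ← measurable_iff_comap_le]
  have key : ((fun γ : Configuration L => ((γ.points : Set (Torus L)) ∩ A.1).ncard) ∘ ofTuple)
      = fun x : Fin n → Torus L =>
          ∑ i : Fin n, if x i ∈ A.1 ∧ ∀ j, j < i → x j ≠ x i then 1 else 0 := by
    funext x
    rw [← Finset.card_filter, Function.comp_apply]
    have : ((ofTuple x).points : Set (Torus L)) ∩ A.1 =
        x '' ({i | x i ∈ A.1 ∧ ∀ j, j < i → x j ≠ x i} : Set (Fin n)) := by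
      ext y
      simp only [ofTuple, Finset.coe_image, Finset.coe_univ, Set.image_univ, Set.mem_inter_iff,
        Set.mem_range, Set.mem_image, Set.mem_ofPred_eq]
      constructor
      · rintro ⟨⟨i, hi⟩, hy⟩
        have hne : (Finset.univ.filter fun k => x k = y).Nonempty := ⟨i, by simp [hi]⟩
        have hm := Finset.min'_mem _ hne
        rw [Finset.mem_filter] at hm
        refine ⟨_, ⟨by rw [hm.2]; exact hy, fun j hj hji => ?_⟩, hm.2⟩
        exact absurd (Finset.min'_le _ j (by simp [hji, hm.2])) (not_le.2 hj)
      · rintro ⟨i, ⟨hi, -⟩, rfl⟩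
        exact ⟨⟨i, rfl⟩, hi⟩
    rw [this, Set.InjOn.ncard_image]
    · rw [← Set.ncard_coe_finset]; simp
    · intro i hi j hj hij
      rcases lt_trichotomy i j with h | h | h
      · exact absurd hij (hj.2 i h)
      · exact h
      · exact absurd hij.symm (hi.2 j h)
  rw [key]
  refine Finset.measurable_sum _ fun i _ => Measurable.ite ?_ measurable_const measurable_const
  have h : MeasurableSet (⋂ j, ⋂ (_ : j < i), {x : Fin n → Torus L | x j = x i}ᶜ) :=
    MeasurableSet.iInter fun j => MeasurableSet.iInter fun _ =>
      (measurableSet_eq_fun (measurable_pi_apply j) (measurable_pi_apply i)).compl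
  convert (measurable_pi_apply (X := fun _ : Fin n => Torus L) i A.2).inter h using 1
  ext x
  simp

/-! ### The Gibbs measure -/

/-- The number of particles `N(γ)`. -/
def numParticles (γ : Configuration L) : ℕ := γ.points.card

/-- The halo `h(γ)`, as a closed subset of the torus. -/
def halo (γ : Configuration L) : Closeds (Torus L) :=
  ⟨dilation (γ.points : Set (Torus L)),
    γ.points.finite_toSet.isClosed_biUnion fun _ _ => Metric.isClosed_closedBall⟩

variable [Fact (0 < L)]

/-- The halo volume `V(γ) = |h(γ)|`. -/
def haloVolume (γ : Configuration L) : ℝ := (area L).real (halo γ : Set (Torus L))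

/-- The area `V₀ = 4π` of a disc of radius `2`. -/
def discArea : ℝ := 4 * Real.pi

/-- The energy `E(γ) = V(γ) - V₀ N(γ)`. -/
def energy (γ : Configuration L) : ℝ := haloVolume γ - discArea * numParticles γ

/-- The grand-canonical Hamiltonian `H(γ) = E(γ) - λ N(γ)` with chemical potential `λ`. -/
def hamiltonian (lam : ℝ) (γ : Configuration L) : ℝ := energy γ - lam * numParticles γ

/-- The grand-canonical partition function `Ξ`. -/
def partitionFunction (L : ℝ) [Fact (0 < L)] (lam β : ℝ) : ℝ≥0∞ :=
  ∫⁻ γ, ENNReal.ofReal (Real.exp (-β * hamiltonian lam γ)) ∂(poissonLaw L)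

/-- The grand-canonical Gibbs measure `Ξ⁻¹ e^{-β H(γ)} ℚ(dγ)`. -/
def gibbsMeasure (L : ℝ) [Fact (0 < L)] (lam β : ℝ) : Measure (Configuration L) :=
  (partitionFunction L lam β)⁻¹ •
    (poissonLaw L).withDensity fun γ => ENNReal.ofReal (Real.exp (-β * hamiltonian lam γ))

/-- The chemical potential of the metastable regime, determined by
`e^{β λ} = κ z_t(β)` with `z_t(β) = β e^{-β V₀}`. -/
def metastablePotential (κ β : ℝ) : ℝ :=
  Real.log (κ * (β * Real.exp (-β * discArea))) / β

/-- The Gibbs measure `μ_β` in the metastable regime. -/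
def metastableGibbs (L : ℝ) [Fact (0 < L)] (κ β : ℝ) : Measure (Configuration L) :=
  gibbsMeasure L (metastablePotential κ β) β

/-- In the metastable regime the Gibbs weight is `(κ β)^{N(γ)} e^{-β V(γ)}`. -/
theorem exp_hamiltonian {κ β : ℝ} (hκ : 0 < κ) (hβ : 0 < β) (γ : Configuration L) :
    Real.exp (-β * hamiltonian (metastablePotential κ β) γ)
      = (κ * β) ^ numParticles γ * Real.exp (-β * haloVolume γ) := by
  have h1 : Real.log (κ * (β * Real.exp (-β * discArea)))
      = Real.log (κ * β) - β * discArea := by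
    rw [← mul_assoc, Real.log_mul (by positivity) (by positivity), Real.log_exp]; ring
  have h2 : -β * hamiltonian (metastablePotential κ β) γ
      = numParticles γ * Real.log (κ * β) + -β * haloVolume γ := by
    simp only [hamiltonian, energy, metastablePotential, h1]
    field_simp
    ring
  rw [h2, Real.exp_add, Real.exp_nat_mul, Real.exp_log (by positivity)]

/-! ### The large deviation principle -/

/-- The law of the halo under `μ_β`, as a measure on a family `𝒜` of closed sets:
`A ↦ μ_β(h(γ) ∈ A)` for Borel `A ⊆ 𝒜`. -/
def haloLaw (κ β : ℝ) (𝒜 : Set (Closeds (Torus L))) : Measure 𝒜 :=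
  ((metastableGibbs L κ β).map halo).comap Subtype.val

/-- The functional `J(S) = |S| - κ |S⁻|`. -/
def J (κ : ℝ) (S : Closeds (Torus L)) : ℝ :=
  (area L).real (S : Set (Torus L)) - κ * (area L).real (erosion (S : Set (Torus L)))

/-- The rate function `I(S) = J(S) - inf J`, the infimum being over the admissible sets. -/
def rate (κ : ℝ) (S : Closeds (Torus L)) : ℝ := J κ S - sInf (J κ '' admissible L)

end WidomRowlinson

/-- The family of measures `(P β)` satisfies, as `β → ∞`, the large deviation principle with
speed `β` and good rate function `I`: `I` is nonnegative, lower semicontinuous and has compact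
level sets, and the upper bound for closed sets and the lower bound for open sets hold. -/
structure SatisfiesLDP {X : Type*} [TopologicalSpace X] [MeasurableSpace X]
    (P : ℝ → Measure X) (I : X → EReal) : Prop where
  nonneg : ∀ x, 0 ≤ I x
  lowerSemicontinuous : LowerSemicontinuous I
  isCompact_level : ∀ a : ℝ, IsCompact {x | I x ≤ a}
  upper : ∀ C : Set X, IsClosed C →
    limsup (fun β : ℝ => ((β⁻¹ : ℝ) : EReal) * ENNReal.log (P β C)) atTop ≤ -⨅ x ∈ C, I x
  lower : ∀ O : Set X, IsOpen O →
    -⨅ x ∈ O, I x ≤ liminf (fun β : ℝ => ((β⁻¹ : ℝ) : EReal) * ENNReal.log (P β O)) atTop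

end

/-!
The weight `(κβ) ^ N(γ) e^{-β V(γ)} ℚ(dγ)` is, up to a factor that does not depend on `γ` and
cancels in the normalisation, the law of a Poisson point process of intensity `κβ` tilted by
`e^{-β V}`. Without the tilt, the event that all particles lie in a set `T` has probability
proportional to `e^{κβ|T|}`. A configuration with halo close to a shape `S` has its particles close to the erosion
`S⁻` and halo area close to `|S|`, so that the event has weight about
`e^{-β(|S| - κ|S⁻|)} = e^{-β J(S)}`.

* Upper bound (`exists_nhds_gibbsWeight_le`). Near `S` the erosions are contained in a common closed
  set hardly larger than `S⁻` (`exists_erosion_subset`), and the area is bounded below by nearly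
  `|S|` on the halos near `S` (`eventually_lt_area`). Lower semicontinuity of the area holds only on
  the halos, not on all closed sets. It rests on the fact that the points at distance exactly `2`
  from a closed set form a null set (`area_dilation_diff_thickening`), which is a consequence of
  Lebesgue's density theorem. The set of shapes is compact, as the image of the compact space of
  closed sets under the `1`-Lipschitz dilation map, and finitely many of the neighbourhoods suffice
  for a closed set of shapes.
* Lower bound (`eventually_le_gibbsWeight`). A Poisson process of high intensity in a small
  neighbourhood of `S⁻` hits with high probability each of finitely many small discs covering `S⁻`
  (`eventually_le_poissonWeight_hitting`), and its halo is then close to the dilation of `S⁻`,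
  that is, to `S`, with area at most slightly above `|S|`.

Applied to all shapes, both bounds give the rate `-inf J` of the normalising constant. The
principle on the admissible sets is obtained together with that on all halos, since the empty set is
isolated (`satisfiesLDP_haloLaw`).
-/

open MeasureTheory Filter Topology TopologicalSpace
open scoped ENNReal

noncomputable section

namespace WidomRowlinson

variable {L : ℝ}

/-! ### The torus as a metric measure space -/

theorem norm_ofLp_le (z : Torus L) : ‖z.ofLp‖ ≤ ‖z‖ := by
  rw [WithLp.prod_norm_eq_of_L2, Prod.norm_def]
  exact max_le (Real.le_sqrt_of_sq_le (le_add_of_nonneg_right (sq_nonneg _)))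
    (Real.le_sqrt_of_sq_le (le_add_of_nonneg_left (sq_nonneg _)))

theorem norm_le_two_mul_norm_ofLp (z : Torus L) : ‖z‖ ≤ 2 * ‖z.ofLp‖ := by
  have h1 : ‖z.fst‖ ≤ ‖z.ofLp‖ := le_max_left _ _
  have h2 : ‖z.snd‖ ≤ ‖z.ofLp‖ := le_max_right _ _
  rw [WithLp.prod_norm_eq_of_L2]
  refine Real.sqrt_le_iff.2 ⟨by positivity, ?_⟩
  nlinarith [norm_nonneg z.fst, norm_nonneg z.snd]

/-- A point of the circle has a real representative that realises its norm. -/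
theorem exists_real_lift (a : AddCircle L) : ∃ p : ℝ, (p : AddCircle L) = a ∧ |p| = ‖a‖ := by
  obtain ⟨x, rfl⟩ := QuotientAddGroup.mk_surjective a
  refine ⟨x - round (L⁻¹ * x) * L, ?_, (AddCircle.norm_eq L).symm⟩
  have : ((round (L⁻¹ * x) * L : ℝ) : AddCircle L) = 0 := by
    rw [← zsmul_eq_mul]
    exact (QuotientAddGroup.eq_zero_iff _).2 ⟨_, rfl⟩
  rw [AddCircle.coe_sub, this, sub_zero]

theorem norm_coe_le_abs (p : ℝ) : ‖(p : AddCircle L)‖ ≤ |p| :=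
  QuotientAddGroup.norm_mk_le_norm

/-- Contraction of a vector of the torus along a shortest geodesic to the origin. -/
theorem exists_contraction (v : Torus L) {t : ℝ} (h0 : 0 ≤ t) (h1 : t ≤ 1) :
    ∃ w : Torus L, ‖w‖ ≤ (1 - t) * ‖v‖ ∧ ‖v - w‖ ≤ t * ‖v‖ := by
  obtain ⟨p, hp, hp'⟩ := exists_real_lift v.fst
  obtain ⟨q, hq, hq'⟩ := exists_real_lift v.snd
  have key : ∀ (s : ℝ), 0 ≤ s → ∀ w : Torus L, w.fst = ((s * p : ℝ) : AddCircle L) →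
      w.snd = ((s * q : ℝ) : AddCircle L) → ‖w‖ ≤ s * ‖v‖ := by
    intro s hs w hw1 hw2
    have hsq : s * ‖v‖ = √(s ^ 2 * (|p| ^ 2 + |q| ^ 2)) := by
      rw [Real.sqrt_mul (sq_nonneg s), Real.sqrt_sq hs, WithLp.prod_norm_eq_of_L2, hp', hq']
    rw [hsq, WithLp.prod_norm_eq_of_L2, hw1, hw2]
    refine Real.sqrt_le_sqrt ?_
    have e1 := norm_coe_le_abs (L := L) (s * p)
    have e2 := norm_coe_le_abs (L := L) (s * q)
    rw [abs_mul, abs_of_nonneg hs] at e1 e2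
    calc _ ≤ (s * |p|) ^ 2 + (s * |q|) ^ 2 := by gcongr
      _ = _ := by ring
  refine ⟨WithLp.toLp 2 ((((1 - t) * p : ℝ) : AddCircle L), (((1 - t) * q : ℝ) : AddCircle L)),
    key _ (by linarith) _ rfl rfl, key t h0 _ ?_ ?_⟩
  · rw [WithLp.sub_fst, ← hp]
    change _ - (((1 - t) * p : ℝ) : AddCircle L) = _
    rw [← AddCircle.coe_sub]; congr 1; ring
  · rw [WithLp.sub_snd, ← hq]
    change _ - (((1 - t) * q : ℝ) : AddCircle L) = _
    rw [← AddCircle.coe_sub]; congr 1; ring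

variable [Fact (0 < L)]

instance : CompactSpace (Torus L) :=
  (WithLp.homeomorphProd 2 (AddCircle L) (AddCircle L)).symm.compactSpace

theorem area_apply (S : Set (Torus L)) : area L S = volume (WithLp.toLp 2 ⁻¹' S) :=
  (MeasurableEquiv.toLp 2 (AddCircle L × AddCircle L)).map_apply S

instance : (area L).IsOpenPosMeasure := ⟨fun U hU hne h0 => by
  rw [area_apply] at h0
  obtain ⟨x, hx⟩ := hne
  exact (hU.preimage (WithLp.prod_continuous_toLp 2 _ _)).measure_ne_zero volume ⟨x.ofLp, hx⟩ h0⟩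

instance : NullSingletonClass (area L) := ⟨fun x => by
  rw [area_apply]
  have : WithLp.toLp 2 ⁻¹' {x} = ({x.fst} ×ˢ {x.snd} : Set (AddCircle L × AddCircle L)) := by
    ext y
    simp only [Set.mem_preimage, Set.mem_singleton_iff, Set.singleton_prod_singleton]
    exact ⟨fun h => by rw [← h]; rfl, fun h => by rw [h]; rfl⟩
  rw [this, Measure.volume_eq_prod, Measure.prod_prod]
  have h0 : volume {x.fst} = 0 := by
    rw [← Metric.closedBall_zero, AddCircle.volume_closedBall]
    simp
  simp [h0]⟩

/-- The doubling property is inherited from the supremum distance on the product of the two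
circles, to which the Euclidean distance is equivalent. -/
instance : IsUnifLocDoublingMeasure (area L) := by
  obtain ⟨C, hC⟩ := IsUnifLocDoublingMeasure.exists_eventually_forall_measure_closedBall_le_mul
    (volume : Measure (AddCircle L × AddCircle L)) 4
  have half : Tendsto (fun ε : ℝ => ε / 2) (𝓝[>] 0) (𝓝[>] 0) := by
    refine tendsto_nhdsWithin_iff.2 ⟨?_, ?_⟩
    · have : Tendsto (fun ε : ℝ => ε / 2) (𝓝 0) (𝓝 (0 / 2)) := tendsto_id.div_const 2
      rw [zero_div] at this
      exact this.mono_left nhdsWithin_le_nhds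
    · filter_upwards [self_mem_nhdsWithin] with ε hε
      exact half_pos (Set.mem_Ioi.1 hε)
  refine ⟨⟨C, ?_⟩⟩
  filter_upwards [half.eventually hC] with ε hε x
  rw [area_apply, area_apply]
  refine le_trans (measure_mono ?_) ((hε x.ofLp 4 le_rfl).trans ?_)
  · intro y hy
    rw [Set.mem_preimage, mem_closedBall_iff_norm] at hy
    rw [mem_closedBall_iff_norm]
    have := norm_ofLp_le (WithLp.toLp 2 y - x)
    rw [WithLp.ofLp_sub] at this
    change ‖y - x.ofLp‖ ≤ _ at this
    linarith
  · gcongr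
    intro y hy
    rw [mem_closedBall_iff_norm] at hy
    rw [Set.mem_preimage, mem_closedBall_iff_norm]
    have := norm_le_two_mul_norm_ofLp (WithLp.toLp 2 y - x)
    rw [WithLp.ofLp_sub] at this
    change _ ≤ 2 * ‖y - x.ofLp‖ at this
    linarith

end WidomRowlinson

namespace WidomRowlinson

variable {L : ℝ}

/-! ### Dilation and erosion -/

theorem erosion_eq_iInter (S : Set (Torus L)) :
    erosion S = ⋂ v ∈ Metric.closedBall (0 : Torus L) 2, (fun x => x + v) ⁻¹' S := by
  ext x
  simp only [erosion, Set.mem_ofPred_eq, Set.mem_iInter, Set.mem_preimage, mem_closedBall_zero_iff]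
  constructor
  · rintro ⟨-, h⟩ v hv
    exact h (by simpa [mem_closedBall_iff_norm] using hv)
  · intro h
    refine ⟨by simpa using h 0 (by simp), fun y hy => ?_⟩
    simpa using h (y - x) (mem_closedBall_iff_norm.1 hy)

theorem erosion_mono {S T : Set (Torus L)} (h : S ⊆ T) : erosion S ⊆ erosion T :=
  fun _ hx => ⟨h hx.1, hx.2.trans h⟩

theorem subset_erosion_dilation (F : Set (Torus L)) : F ⊆ erosion (dilation F) := fun x hx => by
  have h : Metric.closedBall x 2 ⊆ dilation F :=
    Set.subset_biUnion_of_mem (u := fun x => Metric.closedBall x 2) hx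
  exact ⟨h (Metric.mem_closedBall_self zero_le_two), h⟩

theorem dilation_mono {F G : Set (Torus L)} (h : F ⊆ G) : dilation F ⊆ dilation G :=
  Set.biUnion_subset_biUnion_left h

theorem dilation_erosion_subset (S : Set (Torus L)) : dilation (erosion S) ⊆ S :=
  Set.iUnion₂_subset fun _ hx => hx.2

/-- The `2`-interior of a closed set, as a closed set. -/
def erode (S : Closeds (Torus L)) : Closeds (Torus L) :=
  ⟨erosion (S : Set (Torus L)), by
    rw [erosion_eq_iInter]
    exact isClosed_biInter fun v _ => S.isClosed.preimage (continuous_add_const v)⟩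

theorem bot_notMem_admissible : (⊥ : Closeds (Torus L)) ∉ admissible L := by
  rintro ⟨F, ⟨x, hx⟩, hF⟩
  have h : x ∈ dilation (F : Set (Torus L)) := (subset_erosion_dilation _ hx).1
  rw [hF] at h
  exact h

/-- The possible halos: the admissible sets and the empty set. -/
def shapes (L : ℝ) : Set (Closeds (Torus L)) := insert ⊥ (admissible L)

theorem admissible_eq : admissible L = shapes L ∩ {⊥}ᶜ := by
  ext S
  constructor
  · exact fun h => ⟨Or.inr h, fun h' => bot_notMem_admissible (Set.mem_singleton_iff.1 h' ▸ h)⟩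
  · rintro ⟨h | h, h'⟩
    · exact absurd h h'
    · exact h

theorem eventually_subset_cthickening (S : Closeds (Torus L)) {ε : ℝ} (hε : 0 < ε) :
    ∀ᶠ T : Closeds (Torus L) in 𝓝 S, (T : Set (Torus L)) ⊆ Metric.cthickening ε S := by
  filter_upwards [Metric.eball_mem_nhds S (ENNReal.ofReal_pos.2 hε)] with T hT x hx
  rw [Metric.mem_cthickening_iff]
  exact (Metric.infEDist_le_hausdorffEDist_of_mem hx).trans (le_of_lt hT)

variable [Fact (0 < L)]

theorem dilation_eq_cthickening {F : Set (Torus L)} (hF : IsClosed F) :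
    dilation F = Metric.cthickening 2 F :=
  (hF.isCompact.cthickening_eq_biUnion_closedBall zero_le_two).symm

/-- The `2`-halo of a closed set, as a closed set. -/
def dilate (F : Closeds (Torus L)) : Closeds (Torus L) :=
  ⟨dilation (F : Set (Torus L)), by
    rw [dilation_eq_cthickening F.isClosed]; exact Metric.isClosed_cthickening⟩

theorem coe_dilate (F : Closeds (Torus L)) :
    (dilate F : Set (Torus L)) = dilation (F : Set (Torus L)) := rfl

/-- Erosion followed by dilation does nothing to a dilated set. -/
theorem dilate_erode_dilate (F : Closeds (Torus L)) : dilate (erode (dilate F)) = dilate F :=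
  Closeds.ext <| (dilation_erosion_subset _).antisymm (dilation_mono (subset_erosion_dilation _))

/-- Dilation does not increase the Hausdorff distance, because the distance of the torus is
translation invariant. -/
theorem lipschitzWith_dilate :
    LipschitzWith 1 (dilate : Closeds (Torus L) → Closeds (Torus L)) := by
  have half : ∀ (F G : Closeds (Torus L)) (r : ℝ≥0∞), edist F G < r →
      ∀ y ∈ dilation (F : Set (Torus L)), ∃ z ∈ dilation (G : Set (Torus L)), edist y z ≤ r := by
    intro F G r hr y hy
    obtain ⟨x, hx, hyx⟩ := Set.mem_iUnion₂.1 hy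
    obtain ⟨x', hx', hxx'⟩ := Metric.exists_edist_lt_of_hausdorffEDist_lt hx hr
    refine ⟨y - x + x', Set.mem_iUnion₂.2 ⟨x', hx', ?_⟩, ?_⟩
    · rw [mem_closedBall_iff_norm] at hyx ⊢
      simpa using hyx
    · rw [edist_eq_enorm_sub] at hxx' ⊢
      rw [show y - (y - x + x') = x - x' by abel]
      exact hxx'.le
  refine LipschitzWith.of_edist_le fun F G => le_of_forall_gt fun r hr => ?_
  obtain ⟨s, hs, hsr⟩ := exists_between hr
  exact (Metric.hausdorffEDist_le_of_mem_edist (half F G s hs)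
    (half G F s (by rwa [edist_comm]))).trans_lt hsr

theorem shapes_eq_range : shapes L = Set.range dilate := by
  ext S
  constructor
  · rintro (rfl | ⟨F, -, hF⟩)
    · exact ⟨⊥, Closeds.ext (by simp [coe_dilate, dilation])⟩
    · exact ⟨F, Closeds.ext hF⟩
  · rintro ⟨F, rfl⟩
    rcases (F : Set (Torus L)).eq_empty_or_nonempty with h | h
    · exact Or.inl (Closeds.ext (by simp [coe_dilate, dilation, h]))
    · exact Or.inr ⟨F, h, rfl⟩

theorem isCompact_shapes : IsCompact (shapes L) := by
  rw [shapes_eq_range]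
  exact isCompact_range lipschitzWith_dilate.continuous

theorem dilate_erode {S : Closeds (Torus L)} (hS : S ∈ shapes L) : dilate (erode S) = S := by
  rw [shapes_eq_range] at hS
  obtain ⟨F, rfl⟩ := hS
  exact dilate_erode_dilate F

/-- The particle positions, as a closed set. -/
def pointSet (γ : Configuration L) : Closeds (Torus L) :=
  ⟨γ.points, γ.points.finite_toSet.isClosed⟩

theorem halo_eq_dilate (γ : Configuration L) : halo γ = dilate (pointSet γ) := rfl

theorem halo_mem_shapes (γ : Configuration L) : halo γ ∈ shapes L := by
  rw [shapes_eq_range]; exact ⟨_, (halo_eq_dilate γ).symm⟩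

/-! ### Semicontinuity of the areas of a set and of its erosion -/

theorem exists_area_cthickening_lt (S : Closeds (Torus L)) {δ : ℝ} (hδ : 0 < δ) :
    ∃ ε : ℝ, 0 < ε ∧ (area L).real (Metric.cthickening ε S) < (area L).real S + δ := by
  have h := tendsto_measure_cthickening_of_isClosed (μ := area L) (s := (S : Set (Torus L)))
    ⟨1, one_pos, measure_ne_top _ _⟩ S.isClosed
  have h' := (ENNReal.tendsto_toReal (measure_ne_top (area L) _)).comp h
  have := (h'.mono_left (nhdsWithin_le_nhds (s := Set.Ioi 0))).eventually_lt_const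
    (lt_add_of_pos_right _ hδ)
  obtain ⟨ε, h1, h2⟩ := (this.and self_mem_nhdsWithin).exists
  exact ⟨ε, h2, h1⟩

theorem upperSemicontinuous_area :
    UpperSemicontinuous fun S : Closeds (Torus L) => (area L).real (S : Set (Torus L)) := by
  intro S y hy
  obtain ⟨ε, hε, h⟩ := exists_area_cthickening_lt S (sub_pos.2 hy)
  filter_upwards [eventually_subset_cthickening S hε] with T hT
  exact (measureReal_mono hT).trans_lt (by linarith)

/-- Near a closed set `S`, all erosions are contained in a common closed set of area close to
that of the erosion of `S`. -/
theorem exists_erosion_subset (S : Closeds (Torus L)) {δ : ℝ} (hδ : 0 < δ) :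
    ∃ E : Set (Torus L), IsClosed E ∧
      (area L).real E < (area L).real (erosion (S : Set (Torus L))) + δ ∧
      ∀ᶠ T : Closeds (Torus L) in 𝓝 S, erosion (T : Set (Torus L)) ⊆ E := by
  let ε : ℕ → ℝ := fun n => 1 / ((n : ℝ) + 1)
  have hε : ∀ n, 0 < ε n := fun n => Nat.one_div_pos_of_nat
  let K : ℕ → Closeds (Torus L) := fun n =>
    ⟨Metric.cthickening (ε n) (S : Set (Torus L)), Metric.isClosed_cthickening⟩
  have hK : Antitone fun n => (erode (K n) : Set (Torus L)) := fun m n hmn =>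
    erosion_mono (Metric.cthickening_mono (Nat.one_div_le_one_div hmn) _)
  have hinter : ⋂ n, (erode (K n) : Set (Torus L)) = erosion (S : Set (Torus L)) := by
    have hS : ⋂ n, (K n : Set (Torus L)) = S := by
      refine Set.Subset.antisymm (fun x hx => ?_)
        (Set.subset_iInter fun n => Metric.self_subset_cthickening _)
      rw [← S.isClosed.closure_eq, Metric.mem_closure_iff_infEDist_zero]
      have hlim : Tendsto (fun n => ENNReal.ofReal (ε n)) atTop (𝓝 0) := by
        simpa [ε] using ENNReal.tendsto_ofReal tendsto_one_div_add_atTop_nhds_zero_nat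
      exact le_antisymm (ge_of_tendsto' hlim fun n =>
        Metric.mem_cthickening_iff.1 (Set.mem_iInter.1 hx n)) zero_le
    refine Set.Subset.antisymm (fun x hx => ?_)
      (Set.subset_iInter fun n => erosion_mono (Metric.self_subset_cthickening _))
    have hx' : ∀ n, x ∈ erosion (K n : Set (Torus L)) := Set.mem_iInter.1 hx
    rw [← hS]
    exact ⟨Set.mem_iInter.2 fun n => (hx' n).1, Set.subset_iInter fun n => (hx' n).2⟩
  have hlim : Tendsto (fun n => (area L).real (erode (K n) : Set (Torus L))) atTop
      (𝓝 ((area L).real (erosion (S : Set (Torus L))))) := by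
    rw [← hinter]
    exact (ENNReal.tendsto_toReal (measure_ne_top _ _)).comp <| tendsto_measure_iInter_atTop
      (fun n => (erode (K n)).isClosed.measurableSet.nullMeasurableSet) hK
      ⟨0, measure_ne_top _ _⟩
  obtain ⟨n, hn⟩ := (hlim.eventually_lt_const (lt_add_of_pos_right _ hδ)).exists
  refine ⟨erode (K n), (erode (K n)).isClosed, hn, ?_⟩
  filter_upwards [eventually_subset_cthickening S (hε n)] with T hT
  exact erosion_mono hT

/-- The points at distance exactly `2` from a closed set form a null set. At each such point `x`
a fixed proportion of every small disc is closer than `2` to the set, in the direction of a nearest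
point, so that `x` is not a point of density. -/
theorem area_dilation_diff_thickening {F : Set (Torus L)} (hF : IsClosed F) :
    area L (dilation F \ Metric.thickening 2 F) = 0 := by
  set N := dilation F \ Metric.thickening 2 F with hN
  have hNm : MeasurableSet N := by
    rw [hN, dilation_eq_cthickening hF]
    exact Metric.isClosed_cthickening.measurableSet.diff Metric.isOpen_thickening.measurableSet
  have hd := IsUnifLocDoublingMeasure.ae_tendsto_measure_inter_div (area L) N 2
  rw [ae_restrict_iff' hNm] at hd
  refine measure_mono_null (fun x hx => ?_) hd
  rw [Set.mem_compl_iff, Set.mem_ofPred_eq, Classical.not_imp]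
  refine ⟨hx, fun h => ?_⟩
  obtain ⟨y, hy, hxy⟩ := Set.mem_iUnion₂.1 hx.1
  rw [mem_closedBall_iff_norm] at hxy
  let δ : ℕ → ℝ := fun n => 1 / ((n : ℝ) + 1)
  have hδ : ∀ n, 0 < δ n := fun n => Nat.one_div_pos_of_nat
  have hδ1 : ∀ n, δ n ≤ 1 := fun n =>
    (div_le_one (by positivity)).2 (le_add_of_nonneg_left n.cast_nonneg)
  choose w hw1 hw2 using fun n => exists_contraction (x - y) (hδ n).le (hδ1 n)
  have hlim : Tendsto δ atTop (𝓝[>] 0) :=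
    tendsto_nhdsWithin_iff.2 ⟨tendsto_one_div_add_atTop_nhds_zero_nat, .of_forall hδ⟩
  have h1 := h (fun n => y + w n) δ hlim (.of_forall fun n => by
    rw [mem_closedBall_iff_norm, show x - (y + w n) = x - y - w n by abel]
    nlinarith [hw2 n, hδ n])
  refine zero_ne_one (tendsto_nhds_unique (tendsto_const_nhds.congr fun n => ?_) h1)
  have hempty : N ∩ Metric.closedBall (y + w n) (δ n) = ∅ := by
    refine Set.eq_empty_of_forall_notMem fun z hz => hz.1.2 ?_
    rw [Metric.mem_thickening_iff]
    refine ⟨y, hy, ?_⟩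
    have hz2 := mem_closedBall_iff_norm.1 hz.2
    rw [dist_eq_norm, show z - y = (z - (y + w n)) + w n by abel]
    refine (norm_add_le _ _).trans_lt ?_
    nlinarith [hw1 n, hδ n, hδ1 n]
  rw [hempty, measure_empty, ENNReal.zero_div]

theorem lowerSemicontinuous_area_dilate :
    LowerSemicontinuous fun F : Closeds (Torus L) => (area L).real (dilate F : Set (Torus L)) := by
  intro F y hy
  let r : ℕ → ℝ := fun n => 2 - 1 / ((n : ℝ) + 1)
  have hr : ∀ n, r n < 2 := fun n => sub_lt_self _ Nat.one_div_pos_of_nat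
  have hunion : ⋃ n, Metric.thickening (r n) (F : Set (Torus L)) = Metric.thickening 2 F := by
    refine Set.Subset.antisymm (Set.iUnion_subset fun n => Metric.thickening_mono (hr n).le _) ?_
    intro x hx
    obtain ⟨z, hz, hxz⟩ := Metric.mem_thickening_iff.1 hx
    obtain ⟨n, hn⟩ := exists_nat_one_div_lt (sub_pos.2 hxz)
    exact Set.mem_iUnion.2 ⟨n, Metric.mem_thickening_iff.2 ⟨z, hz, by simp only [r]; linarith⟩⟩
  have hmono : Monotone fun n => Metric.thickening (r n) (F : Set (Torus L)) := fun m n hmn =>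
    Metric.thickening_mono (sub_le_sub_left (Nat.one_div_le_one_div hmn) _) _
  have hlim : Tendsto (fun n => (area L).real (Metric.thickening (r n) (F : Set (Torus L)))) atTop
      (𝓝 ((area L).real (dilate F : Set (Torus L)))) := by
    have he : area L (dilate F : Set (Torus L)) = area L (Metric.thickening 2 F) := by
      refine (measure_mono_ae ?_).antisymm (measure_mono ?_)
      · have := area_dilation_diff_thickening F.isClosed
        rwa [← ae_le_set] at this
      · rw [coe_dilate, dilation_eq_cthickening F.isClosed]
        exact Metric.thickening_subset_cthickening _ _
    rw [measureReal_def, he, ← hunion]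
    exact (ENNReal.tendsto_toReal (measure_ne_top _ _)).comp (tendsto_measure_iUnion_atTop hmono)
  obtain ⟨n, hn⟩ := (hlim.eventually_const_lt hy).exists
  filter_upwards [Metric.eball_mem_nhds F (ENNReal.ofReal_pos.2 (sub_pos.2 (hr n)))] with G hG
  refine hn.trans_le (measureReal_mono fun x hx => ?_)
  obtain ⟨z, hz, hxz⟩ := Metric.mem_thickening_iff.1 hx
  rw [Metric.mem_eball, edist_comm] at hG
  obtain ⟨z', hz', hzz'⟩ := Metric.exists_edist_lt_of_hausdorffEDist_lt hz hG
  rw [edist_lt_ofReal] at hzz'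
  refine Set.mem_iUnion₂.2 ⟨z', hz', ?_⟩
  rw [Metric.mem_closedBall]
  linarith [dist_triangle x z z']

/-- The area is lower semicontinuous on the halos. Its sublevel sets there are the images of those
of the area of the dilation under the dilation map, hence compact. -/
theorem eventually_lt_area {S : Closeds (Torus L)} (hS : S ∈ shapes L) {a : ℝ}
    (ha : a < (area L).real (S : Set (Torus L))) :
    ∀ᶠ T in 𝓝 S, T ∈ shapes L → a < (area L).real (T : Set (Torus L)) := by
  have hc : IsClosed (dilate ''
      {F : Closeds (Torus L) | (area L).real (dilate F : Set (Torus L)) ≤ a}) :=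
    ((lowerSemicontinuous_area_dilate.isClosed_preimage a).isCompact.image
      lipschitzWith_dilate.continuous).isClosed
  have hmem : S ∈ (dilate ''
      {F : Closeds (Torus L) | (area L).real (dilate F : Set (Torus L)) ≤ a})ᶜ := by
    rintro ⟨F, hF, rfl⟩
    exact absurd ha (not_lt.2 hF)
  filter_upwards [hc.isOpen_compl.mem_nhds hmem] with T hT hTs
  by_contra hlt
  rw [shapes_eq_range] at hTs
  obtain ⟨F, rfl⟩ := hTs
  exact hT ⟨F, not_lt.1 hlt, rfl⟩

end WidomRowlinson

/-! ### A measurability criterion -/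

/-- In a second countable extended metric space, measurability of a map can be tested on closed
balls. -/
theorem measurable_of_closedEBall {Ω X : Type*} [MeasurableSpace Ω] [PseudoEMetricSpace X]
    [SecondCountableTopology X] [MeasurableSpace X] [BorelSpace X] {f : Ω → X}
    (hf : ∀ x r, MeasurableSet (f ⁻¹' Metric.closedEBall x r)) : Measurable f := by
  refine measurable_of_isOpen fun U hU => ?_
  have hball : ∀ x : U, ∃ r : ℝ≥0∞, 0 < r ∧ Metric.closedEBall (x : X) r ⊆ U := fun x =>
    Metric.nhds_basis_closedEBall.mem_iff.1 (hU.mem_nhds x.2)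
  choose r hr hrU using hball
  obtain ⟨T, hT, hTU⟩ := isOpen_iUnion_countable (fun x : U => Metric.eball (x : X) (r x))
    fun _ => Metric.isOpen_eball
  have hU' : U = ⋃ x ∈ T, Metric.closedEBall (x : X) (r x) := by
    refine Set.Subset.antisymm (fun y hy => ?_) (Set.iUnion₂_subset fun x _ => hrU x)
    have hy' : y ∈ ⋃ x : U, Metric.eball (x : X) (r x) :=
      Set.mem_iUnion.2 ⟨⟨y, hy⟩, Metric.mem_eball_self (hr _)⟩
    rw [← hTU] at hy'
    exact Set.iUnion₂_mono (fun _ _ => Metric.eball_subset_closedEBall) hy'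
  rw [hU', Set.preimage_iUnion₂]
  exact MeasurableSet.biUnion hT fun x _ => hf x (r x)

namespace WidomRowlinson

variable {L : ℝ}

/-! ### Measurability of the halo -/

theorem measurable_count {A : Set (Torus L)} (hA : MeasurableSet A) :
    Measurable fun γ : Configuration L => ((γ.points : Set (Torus L)) ∩ A).ncard :=
  measurable_iff_comap_le.2 <| le_iSup
    (fun A : {A : Set (Torus L) // MeasurableSet A} => MeasurableSpace.comap
      (fun γ : Configuration L => ((γ.points : Set (Torus L)) ∩ A).ncard) ⊤) ⟨A, hA⟩

theorem measurable_numParticles : Measurable (numParticles : Configuration L → ℕ) := by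
  convert measurable_count (L := L) MeasurableSet.univ using 2 with γ
  simp [numParticles]

theorem measurableSet_points_subset {A : Set (Torus L)} (hA : MeasurableSet A) :
    MeasurableSet {γ : Configuration L | (γ.points : Set (Torus L)) ⊆ A} := by
  convert measurable_count hA.compl (measurableSet_singleton 0) using 1
  ext γ
  rw [Set.mem_preimage, Set.mem_singleton_iff,
    Set.ncard_eq_zero (γ.points.finite_toSet.inter_of_left _), ← Set.disjoint_iff_inter_eq_empty,
    Set.disjoint_compl_right_iff_subset]
  rfl

theorem measurableSet_halo_subset {A : Set (Torus L)} (hA : IsClosed A) :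
    MeasurableSet {γ : Configuration L | (halo γ : Set (Torus L)) ⊆ A} := by
  convert measurableSet_points_subset (erode ⟨A, hA⟩).isClosed.measurableSet using 1
  ext γ
  exact ⟨fun h => (subset_erosion_dilation _).trans (erosion_mono h),
    fun h => (dilation_mono h).trans (dilation_erosion_subset A)⟩

theorem measurable_infEDist_halo (x : Torus L) :
    Measurable fun γ : Configuration L => Metric.infEDist x (halo γ : Set (Torus L)) := by
  refine measurable_of_Ici fun r => ?_
  convert measurableSet_halo_subset (L := L) (A := {y | r ≤ edist x y})
    (isClosed_le continuous_const (continuous_const.edist continuous_id)) using 1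
  ext γ
  exact Metric.le_infEDist

variable [Fact (0 < L)]

theorem measurable_halo : Measurable (halo : Configuration L → Closeds (Torus L)) := by
  refine measurable_of_closedEBall fun S r => ?_
  obtain ⟨D, hDS, hDc, hD⟩ := (IsSeparable.of_separableSpace
    (S : Set (Torus L))).exists_countable_dense_subset
  have heq : halo ⁻¹' Metric.closedEBall S r =
      {γ : Configuration L | (halo γ : Set (Torus L)) ⊆
        {x | Metric.infEDist x (S : Set (Torus L)) ≤ r}} ∩
      ⋂ s ∈ D, {γ | Metric.infEDist s (halo γ : Set (Torus L)) ≤ r} := by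
    ext γ
    simp only [Set.mem_preimage, Metric.mem_closedEBall, Set.mem_inter_iff, Set.mem_iInter,
      Set.mem_ofPred_eq]
    constructor
    · intro h
      refine ⟨fun x hx => (Metric.infEDist_le_hausdorffEDist_of_mem hx).trans h, fun s hs => ?_⟩
      rw [edist_comm] at h
      exact (Metric.infEDist_le_hausdorffEDist_of_mem (hDS hs)).trans h
    · rintro ⟨h1, h2⟩
      refine Metric.hausdorffEDist_le_of_infEDist h1 fun s hs => ?_
      have hcl : IsClosed {s | Metric.infEDist s (halo γ : Set (Torus L)) ≤ r} :=
        isClosed_le Metric.continuous_infEDist continuous_const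
      exact closure_minimal h2 hcl (hD hs)
  rw [heq]
  exact (measurableSet_halo_subset (isClosed_le Metric.continuous_infEDist continuous_const)).inter
    (MeasurableSet.biInter hDc fun s _ => measurable_infEDist_halo s measurableSet_Iic)

theorem measurable_haloVolume : Measurable (haloVolume : Configuration L → ℝ) :=
  upperSemicontinuous_area.measurable.comp measurable_halo

/-! ### Poisson weights -/

/-- The Poisson point process of intensity `s`, up to the constant factor `e^{(s - 1) |𝕋|}`:
the measure `s ^ N(γ) ℚ(dγ)`, see `withDensity_poissonLaw`. -/
def poissonWeight (L : ℝ) [Fact (0 < L)] (s : ℝ) : Measure (Configuration L) :=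
  Measure.sum fun n : ℕ =>
    ENNReal.ofReal (Real.exp (-(area L).real Set.univ) / n.factorial * s ^ n) •
      (Measure.pi fun _ : Fin n => area L).map ofTuple

theorem ae_apply_ne_apply {n : ℕ} {i j : Fin n} (hij : i ≠ j) :
    ∀ᵐ x ∂(Measure.pi fun _ : Fin n => area L), x i ≠ x j := by
  obtain _ | m := n
  · exact i.elim0
  obtain ⟨k, rfl⟩ := Fin.exists_succAbove_eq hij.symm
  have hm : MeasurableSet {p : Torus L × (Fin m → Torus L) | p.1 ≠ p.2 k} :=
    (measurableSet_eq_fun (g := fun p : Torus L × (Fin m → Torus L) => p.2 k) measurable_fst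
      ((measurable_pi_apply k).comp measurable_snd)).compl
  have h : ∀ᵐ p ∂((area L).prod (Measure.pi fun _ : Fin m => area L)), p.1 ≠ p.2 k := by
    rw [Measure.ae_prod_iff_ae_ae hm, Measure.ae_ae_comm hm]
    exact .of_forall fun z => by
      simp [ae_iff]
  exact (measurePreserving_piFinSuccAbove
    (fun _ : Fin (m + 1) => area L) i).quasiMeasurePreserving.ae h

theorem ae_numParticles_ofTuple (n : ℕ) :
    ∀ᵐ x ∂(Measure.pi fun _ : Fin n => area L), numParticles (ofTuple x) = n := by
  classical
  have h : ∀ᵐ x ∂(Measure.pi fun _ : Fin n => area L), ∀ i j, i ≠ j → x i ≠ x j :=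
    ae_all_iff.2 fun i => ae_all_iff.2 fun j => by
      by_cases hij : i = j
      · exact .of_forall fun _ h => absurd hij h
      · exact (ae_apply_ne_apply hij).mono fun _ h _ => h
  filter_upwards [h] with x hx
  have hinj : Function.Injective x := fun i j h => by_contra fun hne => hx i j hne h
  simp only [numParticles, ofTuple]
  convert Finset.card_image_of_injective Finset.univ hinj
  simp

theorem withDensity_poissonLaw {s : ℝ} :
    (poissonLaw L).withDensity (fun γ => ENNReal.ofReal (s ^ numParticles γ)) =
      poissonWeight L s := by
  have hmeas : Measurable fun γ : Configuration L => ENNReal.ofReal (s ^ numParticles γ) :=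
    (Measurable.of_discrete (f := fun n : ℕ => ENNReal.ofReal (s ^ n))).comp measurable_numParticles
  rw [poissonLaw, poissonWeight, withDensity_sum]
  congr 1
  funext n
  rw [withDensity_smul_measure, ENNReal.ofReal_mul (by positivity), mul_smul]
  congr 1
  ext G hG
  rw [withDensity_apply _ hG, setLIntegral_map hG hmeas (measurable_ofTuple n),
    lintegral_congr_ae (g := fun _ => ENNReal.ofReal (s ^ n))
      (ae_restrict_of_ae ((ae_numParticles_ofTuple n).mono fun x hx => by simp only [hx])),
    setLIntegral_const, Measure.smul_apply, Measure.map_apply (measurable_ofTuple n) hG,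
    smul_eq_mul]

/-- The Poisson weight of the configurations without particles outside `T`. -/
theorem poissonWeight_points_subset {s : ℝ} (hs : 0 ≤ s) {T : Set (Torus L)}
    (hT : MeasurableSet T) :
    poissonWeight L s {γ | (γ.points : Set (Torus L)) ⊆ T} =
      ENNReal.ofReal (Real.exp (-(area L).real Set.univ) * Real.exp (s * (area L).real T)) := by
  have hterm : ∀ n : ℕ, (Measure.pi fun _ : Fin n => area L).map ofTuple
      {γ | (γ.points : Set (Torus L)) ⊆ T} = ENNReal.ofReal ((area L).real T ^ n) := by
    intro n
    rw [Measure.map_apply (measurable_ofTuple n) (measurableSet_points_subset hT)]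
    have : ofTuple ⁻¹' {γ | (γ.points : Set (Torus L)) ⊆ T} =
        Set.univ.pi fun _ : Fin n => T := by
      ext x
      simp [ofTuple, Set.range_subset_iff]
    rw [this, Measure.pi_pi, Finset.prod_const, Finset.card_univ, Fintype.card_fin,
      ENNReal.ofReal_pow measureReal_nonneg, ofReal_measureReal]
  have hsum : HasSum (fun n : ℕ => Real.exp (-(area L).real Set.univ) / n.factorial * s ^ n *
      (area L).real T ^ n)
      (Real.exp (-(area L).real Set.univ) * Real.exp (s * (area L).real T)) := by
    have := (NormedSpace.expSeries_div_hasSum_exp (s * (area L).real T)).mul_left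
      (Real.exp (-(area L).real Set.univ))
    rw [← Real.exp_eq_exp_ℝ] at this
    refine this.congr_fun fun n => ?_
    rw [mul_pow]; ring
  rw [poissonWeight, Measure.sum_apply _ (measurableSet_points_subset hT), ← hsum.tsum_eq,
    ENNReal.ofReal_tsum_of_nonneg (fun n => by positivity) hsum.summable]
  congr 1
  funext n
  rw [Measure.smul_apply, hterm, smul_eq_mul, ← ENNReal.ofReal_mul (by positivity)]

/-! ### Gibbs weights -/

/-- The unnormalised Gibbs measure `(κβ) ^ N(γ) e^{-β V(γ)} ℚ(dγ)`. -/
def gibbsWeight (L : ℝ) [Fact (0 < L)] (κ β : ℝ) : Measure (Configuration L) :=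
  (poissonWeight L (κ * β)).withDensity fun γ => ENNReal.ofReal (Real.exp (-β * haloVolume γ))

theorem measurable_exp_haloVolume (β : ℝ) : Measurable fun γ : Configuration L =>
    ENNReal.ofReal (Real.exp (-β * haloVolume γ)) :=
  ENNReal.measurable_ofReal.comp (Real.measurable_exp.comp (measurable_haloVolume.const_mul (-β)))

theorem gibbsWeight_eq_withDensity {κ β : ℝ} (hκ : 0 < κ) (hβ : 0 < β) :
    gibbsWeight L κ β = (poissonLaw L).withDensity
      fun γ => ENNReal.ofReal (Real.exp (-β * hamiltonian (metastablePotential κ β) γ)) := by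
  have hmeas : Measurable fun γ : Configuration L => ENNReal.ofReal ((κ * β) ^ numParticles γ) :=
    (Measurable.of_discrete (f := fun n : ℕ => ENNReal.ofReal ((κ * β) ^ n))).comp
      measurable_numParticles
  rw [gibbsWeight, ← withDensity_poissonLaw,
    ← withDensity_mul _ hmeas (measurable_exp_haloVolume β)]
  congr 1
  funext γ
  rw [exp_hamiltonian hκ hβ, ENNReal.ofReal_mul (by positivity), Pi.mul_apply]

theorem metastableGibbs_eq {κ β : ℝ} (hκ : 0 < κ) (hβ : 0 < β) :
    metastableGibbs L κ β = (gibbsWeight L κ β Set.univ)⁻¹ • gibbsWeight L κ β := by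
  rw [metastableGibbs, gibbsMeasure, partitionFunction, gibbsWeight_eq_withDensity hκ hβ,
    withDensity_apply _ MeasurableSet.univ, Measure.restrict_univ]

/-- If all configurations in `G` have no particle outside `T` and a halo of area at least `a`, then
the weight of `G` is at most `e^{-βa}` times that of the configurations in `T`. -/
theorem gibbsWeight_le {κ β : ℝ} (hκ : 0 ≤ κ) (hβ : 0 ≤ β) {G : Set (Configuration L)}
    (hG : MeasurableSet G) {T : Set (Torus L)} (hT : MeasurableSet T) {a : ℝ}
    (h : ∀ γ ∈ G, (γ.points : Set (Torus L)) ⊆ T ∧ a ≤ haloVolume γ) :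
    gibbsWeight L κ β G ≤ ENNReal.ofReal
      (Real.exp (-(area L).real Set.univ) * Real.exp (-β * (a - κ * (area L).real T))) := by
  rw [gibbsWeight, withDensity_apply _ hG]
  calc _ ≤ ∫⁻ _ in G, ENNReal.ofReal (Real.exp (-β * a)) ∂poissonWeight L (κ * β) :=
        setLIntegral_mono' hG fun γ hγ => by
          gcongr ENNReal.ofReal (Real.exp ?_)
          nlinarith [(h γ hγ).2]
    _ = ENNReal.ofReal (Real.exp (-β * a)) * poissonWeight L (κ * β) G := setLIntegral_const _ _
    _ ≤ ENNReal.ofReal (Real.exp (-β * a)) * poissonWeight L (κ * β)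
          {γ | (γ.points : Set (Torus L)) ⊆ T} := by
        gcongr
        exact fun γ hγ => (h γ hγ).1
    _ = _ := by
        rw [poissonWeight_points_subset (by positivity) hT, ← ENNReal.ofReal_mul (by positivity)]
        congr 1
        rw [show -β * (a - κ * (area L).real T) = -β * a + κ * β * (area L).real T by ring,
          Real.exp_add]
        ring

theorem le_gibbsWeight {κ β : ℝ} (hβ : 0 ≤ β) {G : Set (Configuration L)}
    (hG : MeasurableSet G) {a : ℝ} (h : ∀ γ ∈ G, haloVolume γ ≤ a) :
    ENNReal.ofReal (Real.exp (-β * a)) * poissonWeight L (κ * β) G ≤ gibbsWeight L κ β G := by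
  rw [gibbsWeight, withDensity_apply _ hG, ← setLIntegral_const]
  refine setLIntegral_mono' hG fun γ hγ => ?_
  gcongr ENNReal.ofReal (Real.exp ?_)
  nlinarith [h γ hγ]

theorem gibbsWeight_univ_ne_top {κ β : ℝ} (hκ : 0 ≤ κ) (hβ : 0 ≤ β) :
    gibbsWeight L κ β Set.univ ≠ ∞ :=
  ne_top_of_le_ne_top ENNReal.ofReal_ne_top <| gibbsWeight_le hκ hβ MeasurableSet.univ
    MeasurableSet.univ (a := 0) fun _ _ => ⟨Set.subset_univ _, measureReal_nonneg⟩

theorem gibbsWeight_univ_ne_zero {κ β : ℝ} (hκ : 0 ≤ κ) (hβ : 0 ≤ β) :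
    gibbsWeight L κ β Set.univ ≠ 0 := by
  refine ((ENNReal.mul_pos ?_ ?_).trans_le (le_gibbsWeight hβ MeasurableSet.univ
    (a := (area L).real Set.univ) fun _ _ => measureReal_mono (Set.subset_univ _))).ne'
  · simp [Real.exp_pos]
  · have h := poissonWeight_points_subset (L := L) (mul_nonneg hκ hβ) MeasurableSet.univ
    simp only [Set.subset_univ, Set.ofPred_true] at h
    rw [h]
    simp [Real.exp_pos]

/-! ### Exponential bounds for the Gibbs weights -/

/-- The particles of a configuration whose halo is close to `S` lie in a set that is hardly larger
than the erosion of `S`, and the area of the halo is hardly smaller than that of `S`. -/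
theorem exists_nhds_gibbsWeight_le {κ : ℝ} (hκ : 0 ≤ κ) {S : Closeds (Torus L)}
    (hS : S ∈ shapes L) {b : ℝ} (hb : b < J κ S) :
    ∃ U : Set (Closeds (Torus L)), IsOpen U ∧ S ∈ U ∧ ∀ β : ℝ, 0 ≤ β →
      gibbsWeight L κ β (halo ⁻¹' U) ≤
        ENNReal.ofReal (Real.exp (-(area L).real Set.univ) * Real.exp (-β * b)) := by
  set δ := (J κ S - b) / (1 + κ) with hδ
  have hδ0 : 0 < δ := div_pos (sub_pos.2 hb) (by linarith)
  have hδκ : δ * (1 + κ) = J κ S - b := div_mul_cancel₀ _ (by linarith)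
  obtain ⟨E, hE, hEa, hEn⟩ := exists_erosion_subset S hδ0
  have harea := eventually_lt_area hS (sub_lt_self ((area L).real (S : Set (Torus L))) hδ0)
  obtain ⟨U, hU, hUo, hSU⟩ := eventually_nhds_iff.1 (hEn.and harea)
  refine ⟨U, hUo, hSU, fun β hβ => ?_⟩
  refine (gibbsWeight_le hκ hβ (measurable_halo hUo.measurableSet) hE.measurableSet
    fun γ hγ => ⟨(subset_erosion_dilation _).trans (hU _ hγ).1,
      ((hU _ hγ).2 (halo_mem_shapes γ)).le⟩).trans ?_
  gcongr ENNReal.ofReal (_ * Real.exp ?_)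
  have hκE := mul_le_mul_of_nonneg_left hEa.le hκ
  have : b ≤ (area L).real (S : Set (Torus L)) - δ - κ * (area L).real E := by
    unfold J at hδκ
    linarith
  nlinarith

theorem exists_gibbsWeight_le_of_isCompact {κ : ℝ} (hκ : 0 ≤ κ) {K : Set (Closeds (Torus L))}
    (hK : IsCompact K) (hKs : K ⊆ shapes L) {b : ℝ} (hb : ∀ S ∈ K, b < J κ S) :
    ∃ m : ℕ, ∀ β : ℝ, 0 ≤ β → gibbsWeight L κ β (halo ⁻¹' K) ≤
      ENNReal.ofReal (m * (Real.exp (-(area L).real Set.univ) * Real.exp (-β * b))) := by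
  choose! U hUo hSU hU using fun S (hS : S ∈ K) =>
    exists_nhds_gibbsWeight_le hκ (hKs hS) (hb S hS)
  obtain ⟨t, htK, ht⟩ := hK.elim_nhds_subcover U fun S hS => (hUo S hS).mem_nhds (hSU S hS)
  refine ⟨t.card, fun β hβ => ?_⟩
  calc gibbsWeight L κ β (halo ⁻¹' K)
      ≤ gibbsWeight L κ β (⋃ S ∈ t, halo ⁻¹' U S) := by
        refine measure_mono fun γ hγ => ?_
        simpa using ht hγ
    _ ≤ ∑ S ∈ t, gibbsWeight L κ β (halo ⁻¹' U S) := measure_biUnion_finset_le _ _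
    _ ≤ ∑ _S ∈ t, ENNReal.ofReal
          (Real.exp (-(area L).real Set.univ) * Real.exp (-β * b)) :=
        Finset.sum_le_sum fun S hS => hU S (htK S hS) β hβ
    _ = _ := by
        rw [Finset.sum_const, nsmul_eq_mul, ENNReal.ofReal_mul (Nat.cast_nonneg _),
          ENNReal.ofReal_natCast]

/-- A Poisson point process of high intensity on an open set hits each of finitely many given
discs with probability close to one. -/
theorem eventually_le_poissonWeight_hitting {T : Set (Torus L)} (hT : MeasurableSet T)
    {t : Finset (Torus L)} {r : ℝ} (hr : 0 < r) (ht : ∀ y ∈ t, Metric.ball y r ⊆ T) :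
    ∀ᶠ s : ℝ in atTop, ENNReal.ofReal (1 / 2 * (Real.exp (-(area L).real Set.univ) *
        Real.exp (s * (area L).real T))) ≤
      poissonWeight L s {γ | (γ.points : Set (Torus L)) ⊆ T ∧
        ∀ y ∈ t, ∃ x ∈ γ.points, x ∈ Metric.ball y r} := by
  have hball : ∀ y : Torus L, 0 < (area L).real (Metric.ball y r) := fun y =>
    ENNReal.toReal_pos (Metric.measure_ball_pos _ y hr).ne' (measure_ne_top _ _)
  have hlim : Tendsto (fun s : ℝ => ∑ y ∈ t, Real.exp (-(s * (area L).real (Metric.ball y r))))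
      atTop (𝓝 (∑ _y ∈ t, 0)) :=
    tendsto_finsetSum _ fun y _ => Real.tendsto_exp_neg_atTop_nhds_zero.comp
      (tendsto_id.atTop_mul_const (hball y))
  rw [Finset.sum_const_zero] at hlim
  filter_upwards [hlim.eventually_le_const one_half_pos, eventually_ge_atTop 0] with s hs hs0
  have hset : {γ : Configuration L | (γ.points : Set (Torus L)) ⊆ T} \
      ⋃ y ∈ t, {γ | (γ.points : Set (Torus L)) ⊆ T \ Metric.ball y r} ⊆
      {γ | (γ.points : Set (Torus L)) ⊆ T ∧ ∀ y ∈ t, ∃ x ∈ γ.points, x ∈ Metric.ball y r} := by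
    rintro γ ⟨hγ, hγ'⟩
    refine ⟨hγ, fun y hy => ?_⟩
    by_contra! hno
    exact hγ' (Set.mem_iUnion₂.2 ⟨y, hy, fun x hx => ⟨hγ hx, hno x hx⟩⟩)
  refine le_trans ?_ (le_measure_sdiff.trans (measure_mono hset))
  have hunion : poissonWeight L s
      (⋃ y ∈ t, {γ | (γ.points : Set (Torus L)) ⊆ T \ Metric.ball y r}) ≤
      ENNReal.ofReal (∑ y ∈ t, Real.exp (-(area L).real Set.univ) *
        Real.exp (s * (area L).real (T \ Metric.ball y r))) := by
    refine (measure_biUnion_finset_le _ _).trans_eq ?_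
    rw [ENNReal.ofReal_sum_of_nonneg fun y _ => by positivity]
    exact Finset.sum_congr rfl fun y _ =>
      poissonWeight_points_subset hs0 (hT.diff measurableSet_ball)
  refine le_trans ?_ (tsub_le_tsub_left hunion _)
  rw [poissonWeight_points_subset hs0 hT,
    ← ENNReal.ofReal_sub _ (Finset.sum_nonneg fun y _ => by positivity)]
  refine ENNReal.ofReal_le_ofReal ?_
  have hsum : ∑ y ∈ t, Real.exp (-(area L).real Set.univ) *
      Real.exp (s * (area L).real (T \ Metric.ball y r)) =
      (Real.exp (-(area L).real Set.univ) * Real.exp (s * (area L).real T)) *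
        ∑ y ∈ t, Real.exp (-(s * (area L).real (Metric.ball y r))) := by
    rw [Finset.mul_sum]
    refine Finset.sum_congr rfl fun y hy => ?_
    rw [measureReal_sdiff (ht y hy) measurableSet_ball, mul_assoc, mul_sub, sub_eq_add_neg,
      Real.exp_add]
  rw [hsum]
  have hpos : 0 < Real.exp (-(area L).real Set.univ) * Real.exp (s * (area L).real T) := by
    positivity
  nlinarith

/-- The particles are placed in a small neighbourhood of the erosion of `S` and hit each of finitely
many small discs that cover this erosion. Their halo is then close to `S`. -/
theorem eventually_le_gibbsWeight {κ : ℝ} (hκ : 0 < κ) {S : Closeds (Torus L)}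
    (hS : S ∈ shapes L) {U : Set (Closeds (Torus L))} (hU : IsOpen U) (hSU : S ∈ U) {b : ℝ}
    (hb : J κ S < b) :
    ∀ᶠ β : ℝ in atTop, ENNReal.ofReal (1 / 2 * (Real.exp (-(area L).real Set.univ) *
      Real.exp (-β * b))) ≤ gibbsWeight L κ β (halo ⁻¹' U) := by
  set a := (area L).real (S : Set (Torus L)) + (b - J κ S) with ha
  have hnhds : U ∩ {T : Closeds (Torus L) | (area L).real (T : Set (Torus L)) < a} ∈ 𝓝 S :=
    inter_mem (hU.mem_nhds hSU) (upperSemicontinuous_area S a (by linarith))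
  obtain ⟨ε, hε, hεU⟩ := Metric.nhds_basis_closedEBall.mem_iff.1 hnhds
  obtain ⟨r, hr, hrε⟩ : ∃ r : ℝ, 0 < r ∧ ENNReal.ofReal (2 * r) ≤ ε := by
    obtain ⟨q, hq0, hqε⟩ := ENNReal.lt_iff_exists_nnreal_btwn.1 hε
    refine ⟨q / 2, half_pos (by exact_mod_cast hq0), ?_⟩
    rw [mul_div_cancel₀ _ two_ne_zero, ENNReal.ofReal_coe_nnreal]
    exact hqε.le
  set F := erode S with hF
  set T := Metric.thickening r (F : Set (Torus L)) with hT
  obtain ⟨t, htF, htfin, htcov⟩ := F.isClosed.isCompact.finite_cover_balls hr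
  lift t to Finset (Torus L) using htfin
  have hhit := eventually_le_poissonWeight_hitting (t := t) (T := T)
    Metric.isOpen_thickening.measurableSet hr
    fun y hy => Metric.ball_subset_thickening (htF hy) r
  have hscale : Tendsto (fun β : ℝ => κ * β) atTop atTop := tendsto_id.const_mul_atTop hκ
  filter_upwards [hscale.eventually hhit, eventually_ge_atTop 0] with β hβ hβ0
  have hclose : {γ : Configuration L | (γ.points : Set (Torus L)) ⊆ T ∧
      ∀ y ∈ t, ∃ x ∈ γ.points, x ∈ Metric.ball y r} ⊆
      halo ⁻¹' (U ∩ {T | (area L).real (T : Set (Torus L)) < a}) := by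
    rintro γ ⟨hγT, hγt⟩
    refine hεU (le_trans ?_ hrε)
    have h1 : edist (halo γ) S ≤ edist (pointSet γ) F := by
      conv_lhs => rw [← dilate_erode hS, halo_eq_dilate]
      simpa using lipschitzWith_dilate (pointSet γ) F
    refine h1.trans (Metric.hausdorffEDist_le_of_mem_edist (fun x hx => ?_) fun z hz => ?_)
    · obtain ⟨z, hz, hxz⟩ := Metric.mem_thickening_iff.1 (hγT hx)
      exact ⟨z, hz, by rw [edist_dist]; exact ENNReal.ofReal_le_ofReal (by linarith)⟩
    · obtain ⟨y, hy, hzy⟩ := Set.mem_iUnion₂.1 (htcov hz)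
      obtain ⟨x, hx, hxy⟩ := hγt y hy
      refine ⟨x, hx, ?_⟩
      rw [edist_dist]
      rw [Metric.mem_ball] at hzy hxy
      exact ENNReal.ofReal_le_ofReal (by linarith [dist_triangle_right z x y])
  have hmeas : MeasurableSet
      (halo (L := L) ⁻¹' (U ∩ {T | (area L).real (T : Set (Torus L)) < a})) :=
    measurable_halo (hU.measurableSet.inter
      (upperSemicontinuous_area.measurable measurableSet_Iio))
  calc _ ≤ ENNReal.ofReal (Real.exp (-β * a)) * ENNReal.ofReal (1 / 2 *
          (Real.exp (-(area L).real Set.univ) * Real.exp (κ * β * (area L).real T))) := by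
        rw [← ENNReal.ofReal_mul (by positivity)]
        refine ENNReal.ofReal_le_ofReal ?_
        have hST : (area L).real (erosion (S : Set (Torus L))) ≤ (area L).real T :=
          measureReal_mono (Metric.self_subset_thickening hr _)
        have hexp : Real.exp (-β * b) ≤ Real.exp (-β * a) * Real.exp (κ * β * (area L).real T) := by
          rw [← Real.exp_add, Real.exp_le_exp]
          have : a = b + κ * (area L).real (erosion (S : Set (Torus L))) := by
            rw [ha, J]; ring
          rw [this]
          nlinarith [mul_le_mul_of_nonneg_left hST (mul_nonneg hκ.le hβ0)]
        calc _ ≤ 1 / 2 * (Real.exp (-(area L).real Set.univ) *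
              (Real.exp (-β * a) * Real.exp (κ * β * (area L).real T))) := by gcongr
          _ = _ := by ring
    _ ≤ ENNReal.ofReal (Real.exp (-β * a)) * poissonWeight L (κ * β)
          (halo ⁻¹' (U ∩ {T | (area L).real (T : Set (Torus L)) < a})) := by
        gcongr
        exact hβ.trans (measure_mono hclose)
    _ ≤ gibbsWeight L κ β (halo ⁻¹' (U ∩ {T | (area L).real (T : Set (Torus L)) < a})) :=
        le_gibbsWeight hβ0 hmeas fun γ hγ => le_of_lt hγ.2
    _ ≤ _ := measure_mono (Set.preimage_mono Set.inter_subset_left)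

end WidomRowlinson

/-! ### Exponential rates -/

theorem limsup_inv_mul_log_le {P : ℝ → ℝ≥0∞} {K z : ℝ} (hK : 0 < K)
    (h : ∀ᶠ β in atTop, P β ≤ ENNReal.ofReal (K * Real.exp (β * z))) :
    limsup (fun β : ℝ => ((β⁻¹ : ℝ) : EReal) * ENNReal.log (P β)) atTop ≤ z := by
  have hlim : Tendsto (fun β : ℝ => ((β⁻¹ * Real.log K + z : ℝ) : EReal)) atTop
      (𝓝 (z : EReal)) := by
    refine (continuous_coe_real_ereal.tendsto z).comp ?_
    simpa using (tendsto_inv_atTop_zero.mul_const (Real.log K)).add_const z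
  rw [← hlim.limsup_eq]
  refine limsup_le_limsup ?_
  filter_upwards [h, eventually_gt_atTop 0] with β hβ h0
  calc _ ≤ ((β⁻¹ : ℝ) : EReal) * ENNReal.log (ENNReal.ofReal (K * Real.exp (β * z))) :=
        mul_le_mul_of_nonneg_left (ENNReal.log_le_log hβ) (by exact_mod_cast (inv_pos.2 h0).le)
    _ = _ := by
        rw [ENNReal.log_ofReal_of_pos (by positivity), ← EReal.coe_mul,
          Real.log_mul hK.ne' (Real.exp_ne_zero _), Real.log_exp, mul_add,
          inv_mul_cancel_left₀ h0.ne']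

theorem le_liminf_inv_mul_log {P : ℝ → ℝ≥0∞} {K z : ℝ} (hK : 0 < K)
    (h : ∀ᶠ β in atTop, ENNReal.ofReal (K * Real.exp (β * z)) ≤ P β) :
    z ≤ liminf (fun β : ℝ => ((β⁻¹ : ℝ) : EReal) * ENNReal.log (P β)) atTop := by
  have hlim : Tendsto (fun β : ℝ => ((β⁻¹ * Real.log K + z : ℝ) : EReal)) atTop
      (𝓝 (z : EReal)) := by
    refine (continuous_coe_real_ereal.tendsto z).comp ?_
    simpa using (tendsto_inv_atTop_zero.mul_const (Real.log K)).add_const z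
  rw [← hlim.liminf_eq]
  refine liminf_le_liminf ?_
  filter_upwards [h, eventually_gt_atTop 0] with β hβ h0
  calc _ = ((β⁻¹ : ℝ) : EReal) * ENNReal.log (ENNReal.ofReal (K * Real.exp (β * z))) := by
        rw [ENNReal.log_ofReal_of_pos (by positivity), ← EReal.coe_mul,
          Real.log_mul hK.ne' (Real.exp_ne_zero _), Real.log_exp, mul_add,
          inv_mul_cancel_left₀ h0.ne']
    _ ≤ _ := mul_le_mul_of_nonneg_left (ENNReal.log_le_log hβ)
        (by exact_mod_cast (inv_pos.2 h0).le)

namespace WidomRowlinson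

variable {L : ℝ}

/-! ### The rate function -/

theorem top_mem_admissible : (⊤ : Closeds (Torus L)) ∈ admissible L :=
  ⟨⊤, ⟨0, trivial⟩, Set.eq_univ_of_univ_subset fun _ hx => (subset_erosion_dilation _ hx).1⟩

variable [Fact (0 < L)]

/-- `J` is lower semicontinuous on the halos. -/
theorem eventually_lt_J {κ : ℝ} (hκ : 0 ≤ κ) {S : Closeds (Torus L)} (hS : S ∈ shapes L) {b : ℝ}
    (hb : b < J κ S) : ∀ᶠ T in 𝓝 S, T ∈ shapes L → b < J κ T := by
  set δ := (J κ S - b) / (1 + κ) with hδ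
  have hδ0 : 0 < δ := div_pos (sub_pos.2 hb) (by linarith)
  have hδκ : δ * (1 + κ) = J κ S - b := div_mul_cancel₀ _ (by linarith)
  obtain ⟨E, -, hEa, hEn⟩ := exists_erosion_subset S hδ0
  filter_upwards [hEn, eventually_lt_area hS (sub_lt_self _ hδ0)] with T hTE hTa hT
  have h1 := hTa hT
  have h2 := mul_le_mul_of_nonneg_left ((measureReal_mono hTE).trans hEa.le) hκ
  unfold J at hδκ ⊢
  linarith

theorem bddBelow_J {κ : ℝ} (hκ : 0 ≤ κ) : BddBelow (J κ '' admissible L) := by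
  refine ⟨-(κ * (area L).real Set.univ), ?_⟩
  rintro _ ⟨S, -, rfl⟩
  have h1 : (area L).real (erosion (S : Set (Torus L))) ≤ (area L).real Set.univ :=
    measureReal_mono (Set.subset_univ _)
  have h2 := mul_le_mul_of_nonneg_left h1 hκ
  have h3 : 0 ≤ (area L).real (S : Set (Torus L)) := measureReal_nonneg
  unfold J
  linarith

/-- For `κ ≥ 1` the full torus has nonpositive `J`, so that the infimum of `J` over the
admissible sets is also a lower bound at the empty set. -/
theorem sInf_J_le {κ : ℝ} (hκ : 1 ≤ κ) {S : Closeds (Torus L)} (hS : S ∈ shapes L) :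
    sInf (J κ '' admissible L) ≤ J κ S := by
  have hκ0 : 0 ≤ κ := by linarith
  rcases hS with rfl | hS
  · refine (csInf_le (bddBelow_J hκ0) ⟨⊤, top_mem_admissible, rfl⟩).trans ?_
    have h1 : erosion (Set.univ : Set (Torus L)) = Set.univ :=
      Set.eq_univ_of_forall fun x => ⟨trivial, Set.subset_univ _⟩
    have h2 : erosion (∅ : Set (Torus L)) = ∅ := Set.eq_empty_of_forall_notMem fun x hx => hx.1
    have h3 : 0 ≤ (area L).real Set.univ := measureReal_nonneg
    simp only [J, Closeds.coe_top, Closeds.coe_bot, h1, h2, measureReal_empty]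
    nlinarith
  · exact csInf_le (bddBelow_J hκ0) ⟨S, hS, rfl⟩

/-! ### The large deviation principle -/

theorem haloLaw_apply {κ β : ℝ} (hκ : 0 < κ) (hβ : 0 < β) {𝒜 : Set (Closeds (Torus L))}
    (h𝒜 : MeasurableSet 𝒜) {C : Set 𝒜} (hC : MeasurableSet C) :
    haloLaw κ β 𝒜 C =
      (gibbsWeight L κ β Set.univ)⁻¹ * gibbsWeight L κ β (halo ⁻¹' (Subtype.val '' C)) := by
  rw [haloLaw, (MeasurableEmbedding.subtype_coe h𝒜).comap_apply, metastableGibbs_eq hκ hβ,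
    Measure.map_apply measurable_halo (h𝒜.subtype_image hC), Measure.smul_apply, smul_eq_mul]

theorem isProbabilityMeasure_haloLaw_shapes {κ β : ℝ} (hκ : 0 < κ) (hβ : 0 < β) :
    IsProbabilityMeasure (haloLaw κ β (shapes L)) := by
  refine ⟨?_⟩
  rw [haloLaw_apply hκ hβ isCompact_shapes.isClosed.measurableSet MeasurableSet.univ]
  have : halo ⁻¹' (Subtype.val '' (Set.univ : Set (shapes L))) = Set.univ := by
    ext γ
    simpa using halo_mem_shapes γ
  rw [this]
  exact ENNReal.inv_mul_cancel (gibbsWeight_univ_ne_zero hκ.le hβ.le)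
    (gibbsWeight_univ_ne_top hκ.le hβ.le)

/-- The large deviation principle on every closed family of halos that is relatively open among
all halos. -/
theorem satisfiesLDP_haloLaw {κ : ℝ} (hκ : 1 < κ) {𝒜 V : Set (Closeds (Torus L))}
    (h𝒜 : IsClosed 𝒜) (hV : IsOpen V) (hAV : 𝒜 = shapes L ∩ V) :
    SatisfiesLDP (fun β : ℝ => haloLaw κ β 𝒜) (fun S => ((rate κ S.1 : ℝ) : EReal)) := by
  have hκ0 : 0 < κ := by linarith
  have hsub : 𝒜 ⊆ shapes L := hAV ▸ Set.inter_subset_left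
  set i := sInf (J κ '' admissible L) with hi
  set c := Real.exp (-(area L).real Set.univ) with hc
  have hc0 : 0 < c := Real.exp_pos _
  have : CompactSpace 𝒜 :=
    isCompact_iff_compactSpace.1 (isCompact_shapes.of_isClosed_subset h𝒜 hsub)
  have hlsc : LowerSemicontinuous fun S : 𝒜 => ((rate κ S.1 : ℝ) : EReal) := by
    refine continuous_coe_real_ereal.comp_lowerSemicontinuous (f := fun S : 𝒜 => rate κ S.1)
      (fun S y hy => ?_) EReal.coe_strictMono.monotone
    have hy' : y + i < J κ S.1 := by
      have : y < J κ S.1 - i := hy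
      linarith
    filter_upwards [continuous_subtype_val.continuousAt.eventually
      (eventually_lt_J hκ0.le (hsub S.2) hy')] with T hT
    have := hT (hsub T.2)
    change y < J κ T.1 - i
    linarith
  refine ⟨fun S => ?_, hlsc, fun a => (hlsc.isClosed_preimage a).isCompact, fun C hC => ?_,
    fun O hO => ?_⟩
  · exact EReal.coe_nonneg.2 (sub_nonneg.2 (sInf_J_le hκ.le (hsub S.2)))
  · refine EReal.le_of_forall_lt_iff_le.1 fun z hz => ?_
    obtain ⟨z', hz', hz'z⟩ := EReal.lt_iff_exists_real_btwn.1 hz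
    have hz'z : z' < z := EReal.coe_lt_coe_iff.1 hz'z
    have hJ : ∀ S ∈ Subtype.val '' C, i - z' < J κ S := by
      rintro _ ⟨S, hS, rfl⟩
      have h1 : -(z' : EReal) < ((rate κ S.1 : ℝ) : EReal) :=
        (EReal.neg_lt_comm.1 hz').trans_le (iInf₂_le S hS)
      have h2 : -z' < J κ S.1 - i := by exact_mod_cast h1
      linarith
    obtain ⟨m, hm⟩ := exists_gibbsWeight_le_of_isCompact hκ0.le
      (hC.isCompact.image continuous_subtype_val) (by rintro _ ⟨S, -, rfl⟩; exact hsub S.2) hJ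
    -- The gap `z - z'` absorbs the error in the lower bound for the normalising constant, which
    -- is bounded below near an almost minimiser of `J`.
    obtain ⟨_, ⟨S, hS, rfl⟩, hSi⟩ := exists_lt_of_csInf_lt (s := J κ '' admissible L)
      ⟨_, ⊤, top_mem_admissible, rfl⟩ (show i < i + (z - z') by linarith)
    have hlow := eventually_le_gibbsWeight hκ0 (Or.inr hS : S ∈ shapes L) isOpen_univ trivial hSi
    refine limsup_inv_mul_log_le (K := 2 * (m + 1)) (by positivity) ?_
    filter_upwards [hlow, eventually_gt_atTop 0] with β hβ hβ0
    rw [haloLaw_apply hκ0 hβ0 h𝒜.measurableSet hC.measurableSet]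
    rw [Set.preimage_univ] at hβ
    calc _ ≤ (ENNReal.ofReal (1 / 2 * (c * Real.exp (-β * (i + (z - z'))))))⁻¹ *
          ENNReal.ofReal (m * (c * Real.exp (-β * (i - z')))) :=
          mul_le_mul' (ENNReal.inv_le_inv.2 hβ) (hm β hβ0.le)
      _ = ENNReal.ofReal (2 * m * Real.exp (β * z)) := by
          rw [← ENNReal.ofReal_inv_of_pos (by positivity), ← ENNReal.ofReal_mul (by positivity)]
          congr 1
          rw [show -β * (i - z') = -β * (i + (z - z')) + β * z by ring, Real.exp_add]
          field_simp
      _ ≤ _ := by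
          gcongr
          linarith
  · refine EReal.ge_of_forall_gt_iff_ge.1 fun z hz => ?_
    have hz' := EReal.lt_neg_comm.1 hz
    simp only [iInf_lt_iff] at hz'
    obtain ⟨S, hSO, hS⟩ := hz'
    have hS : J κ S.1 - i < -z := by exact_mod_cast hS
    obtain ⟨U, hU, rfl⟩ := isOpen_induced_iff.1 hO
    -- Half of the gap is lost in the lower bound for the numerator, half in the upper bound for the
    -- normalising constant.
    set η := (i - z - J κ S.1) / 2 with hη
    have hη0 : 0 < η := by rw [hη]; linarith
    have hSV : S.1 ∈ V := (hAV ▸ S.2 : S.1 ∈ shapes L ∩ V).2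
    have hlow := eventually_le_gibbsWeight hκ0 (hsub S.2) (hU.inter hV) ⟨hSO, hSV⟩
      (show J κ S.1 < i - z - η by rw [hη]; linarith)
    obtain ⟨m, hm⟩ := exists_gibbsWeight_le_of_isCompact hκ0.le (isCompact_shapes (L := L))
      Set.Subset.rfl (b := i - η) fun T hT => (sub_lt_self _ hη0).trans_le (sInf_J_le hκ.le hT)
    have huniv : halo ⁻¹' shapes L = (Set.univ : Set (Configuration L)) :=
      Set.eq_univ_of_forall halo_mem_shapes
    rw [huniv] at hm
    refine le_liminf_inv_mul_log (K := (2 * (m + 1))⁻¹) (by positivity) ?_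
    filter_upwards [hlow, eventually_gt_atTop 0] with β hβ hβ0
    rw [haloLaw_apply hκ0 hβ0 h𝒜.measurableSet hO.measurableSet]
    have hpre : halo ⁻¹' (Subtype.val '' (Subtype.val ⁻¹' U : Set 𝒜)) =
        (halo ⁻¹' (U ∩ V) : Set (Configuration L)) := by
      rw [Subtype.image_preimage_coe, hAV]
      ext γ
      have := halo_mem_shapes γ
      simp only [Set.mem_preimage, Set.mem_inter_iff]
      tauto
    rw [hpre]
    calc _ = (ENNReal.ofReal ((m + 1) * (c * Real.exp (-β * (i - η)))))⁻¹ *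
          ENNReal.ofReal (1 / 2 * (c * Real.exp (-β * (i - z - η)))) := by
          rw [← ENNReal.ofReal_inv_of_pos (by positivity), ← ENNReal.ofReal_mul (by positivity)]
          congr 1
          rw [show -β * (i - z - η) = -β * (i - η) + β * z by ring, Real.exp_add]
          field_simp
      _ ≤ _ := by
          refine mul_le_mul' (ENNReal.inv_le_inv.2 ((hm β hβ0.le).trans ?_)) hβ
          gcongr
          linarith

end WidomRowlinson

theorem mainTheorem4 (L κ : ℝ) [Fact (0 < L)] (hL : 4 < L) (hκ : 1 < κ) :
    (∀ β : ℝ, 1 ≤ β → MeasureTheory.IsProbabilityMeasure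
      (WidomRowlinson.haloLaw κ β (insert ⊥ (WidomRowlinson.admissible L)))) ∧
    SatisfiesLDP
      (fun β : ℝ => WidomRowlinson.haloLaw κ β (insert ⊥ (WidomRowlinson.admissible L)))
      (fun S => ((WidomRowlinson.rate κ S.1 : ℝ) : EReal)) ∧
    SatisfiesLDP
      (fun β : ℝ => WidomRowlinson.haloLaw κ β (WidomRowlinson.admissible L))
      (fun S => ((WidomRowlinson.rate κ S.1 : ℝ) : EReal)) := by
  have hbot : IsOpen ({⊥}ᶜ : Set (Closeds (WidomRowlinson.Torus L))) :=
    isClosed_singleton.isOpen_compl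
  have hbot' : IsClosed ({⊥}ᶜ : Set (Closeds (WidomRowlinson.Torus L))) :=
    Closeds.isClopen_singleton_bot.isOpen.isClosed_compl
  refine ⟨fun β hβ =>
      WidomRowlinson.isProbabilityMeasure_haloLaw_shapes (by linarith) (by linarith),
    WidomRowlinson.satisfiesLDP_haloLaw hκ WidomRowlinson.isCompact_shapes.isClosed isOpen_univ
      (Set.inter_univ _).symm,
    WidomRowlinson.satisfiesLDP_haloLaw hκ ?_ hbot WidomRowlinson.admissible_eq⟩
  rw [WidomRowlinson.admissible_eq]
  exact WidomRowlinson.isCompact_shapes.isClosed.inter hbot'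

end
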